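/- For $k\ge 0$ let $\mathbb H_k(x)=(2^k k!\sqrt{\pi})^{-1/2}H_k(x)$, where $H_k(x)=(-1)^k e^{x^2}\frac{d^k}{dx^k}e^{-x^2}$, be the Hermite polynomials orthonormal in $L^2(\mathbb R,e^{-x^2}dx)$. Let $f:\mathbb R\to\mathbb C$ be a (Lebesgue) measurable function for which there is some $a>0$ with $$\int_{-\infty}^{\infty}|f(x)|\,e^{a|x|-x^2}\,dx<\infty \qquad (*)$$ (for instance any $f\in L^2(\mathbb R,e^{-x^2}dx)$, or any $f\in L^p(\mathbb R,e^{-x^2}dx)$ with $p>1$), and put $$f_k=\int_{-\infty}^{\infty}f(x)\,\mathbb H_k(x)\,e^{-x^2}\,dx,\qquad k=0,1,2,\dots$$ Then $$\sum_{k=0}^{\infty}|f_k|^2\theta^k<\infty\quad\text{for all }\theta>1$$ if and only if $f$ coincides almost everywhere on $\mathbb R$ with the restriction to $\mathbb R$ of an entire function $F$ such that for every $\varepsilon>0$ there is a constant $C=C(\varepsilon)$, independent of $z$, with $|F(z)|\le C e^{\varepsilon|z|^2}$ for all $z\in\mathbb C$. Moreover, every function $f$ that coincides almost everywhere with the restriction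 of such an $F$ automatically is measurable and satisfies $(*)$ for some $a>0$. -/

import Mathlib

open MeasureTheory

noncomputable section

/-- The physicists' Hermite polynomial `H_k` (orthogonal for the weight `e^{-x²}`, leading
coefficient `2^k`), evaluated at a real point. Mathlib's `Polynomial.hermite` is the probabilists'
polynomial `He_k`, orthogonal for `e^{-x²/2}`, and `H_k(x) = 2^{k/2} He_k(√2 x)`. -/
def physHermite (k : ℕ) (x : ℝ) : ℝ :=
  √2 ^ k * Polynomial.aeval (√2 * x) (Polynomial.hermite k)

/-- The Hermite polynomial of degree `k`, orthonormal in `L²(ℝ, e^{-x²} dx)`; the squared norm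
of `H_k` in that space is `2^k k! √π`. -/
def orthoHermite (k : ℕ) (x : ℝ) : ℝ :=
  physHermite k x / √(2 ^ k * (k.factorial : ℝ) * √Real.pi)

/-- The `k`-th Fourier-Hermite coefficient `f_k = ∫ f(x) ℍ_k(x) e^{-x²} dx`. -/
def hermiteCoeff (f : ℝ → ℂ) (k : ℕ) : ℂ :=
  ∫ x : ℝ, f x * (orthoHermite k x : ℂ) * (Real.exp (-x ^ 2) : ℂ)

end

/-! Write `h_k` for the orthonormal Hermite polynomials. Everything rests on the bound `|h_k(z)| ≤
exp(3|z|√k)` (`norm_complexHermite_le`), hence `|h_k(z)| ≤ B ^ k * exp(ε|z|²)` with `B` depending on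
`ε` only.

If the weighted sums converge for all `θ > 1`, then `∑ |f_k| B ^ k` converges for every `B`, so `F =
∑ f_k h_k` is entire of minimal type. Integrating termwise, `F` has the coefficients `f_k`. Then `f
- F` has zero coefficients, and it vanishes a.e. because an exponential moment makes the moment
problem determinate: the complex moment generating function is analytic on a strip containing the
imaginary axis, where it is the characteristic function.

Conversely, integrating by parts `k` times turns `√(2 ^ k k!) F_k` into the zeroth coefficient of
the `k`-th derivative of `F`. Cauchy's estimate on circles of radius proportional to `√(k + 1)`
gives `F_k = O(q ^ k)` for every `q > 0` (`exists_norm_hermiteCoeff_le`). -/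

noncomputable section

/-! ### Hermite polynomials on the complex plane: derivatives and recurrence. -/

theorem Polynomial.derivative_hermite_succ (k : ℕ) :
    derivative (hermite (k + 1)) = (k + 1 : ℕ) • hermite k := by
  induction k with
  | zero => simp
  | succ k ih =>
    rw [hermite_succ (k + 1), derivative_sub, derivative_mul, derivative_X, ih,
      derivative_smul, one_mul, hermite_succ k]
    simp only [nsmul_eq_mul]
    push_cast
    ring

/-- The orthonormal Hermite polynomials as functions on the complex plane. -/
def complexHermite (k : ℕ) (z : ℂ) : ℂ :=
  (√2 : ℝ) ^ k * Polynomial.aeval ((√2 : ℝ) * z) (Polynomial.hermite k) /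
    (√(2 ^ k * (k.factorial : ℝ) * √Real.pi) : ℝ)

theorem complexHermite_ofReal (k : ℕ) (x : ℝ) : complexHermite k x = orthoHermite k x := by
  have h : Polynomial.aeval (((√2 : ℝ) : ℂ) * x) (Polynomial.hermite k)
      = ((Polynomial.aeval (√2 * x) (Polynomial.hermite k) : ℝ) : ℂ) := by
    rw [← Complex.ofReal_mul]
    exact Polynomial.aeval_algebraMap_apply ℂ (√2 * x) (Polynomial.hermite k)
  rw [complexHermite, h, orthoHermite, physHermite]
  push_cast
  rfl

theorem sqrt_two_pow_factorial_succ (k : ℕ) :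
    √(2 ^ (k + 1) * ((k + 1).factorial : ℝ) * √Real.pi)
      = √(2 * (k + 1)) * √(2 ^ k * (k.factorial : ℝ) * √Real.pi) := by
  rw [← Real.sqrt_mul (by positivity)]
  congr 1
  rw [Nat.factorial_succ]
  push_cast
  ring

theorem ofReal_sqrt_mul_self {a : ℝ} (ha : 0 ≤ a) : ((√a : ℝ) : ℂ) * (√a : ℝ) = a := by
  rw [← Complex.ofReal_mul, Real.mul_self_sqrt ha]

theorem sqrt_two_mul_succ_ne_zero (k : ℕ) : ((√(2 * (k + 1)) : ℝ) : ℂ) ≠ 0 := by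
  have : 0 < √(2 * ((k : ℝ) + 1)) := by positivity
  exact_mod_cast this.ne'

theorem hasDerivAt_complexHermite_aux (k : ℕ) (z : ℂ) :
    HasDerivAt (complexHermite k)
      ((√2 : ℝ) ^ k * (Polynomial.aeval ((√2 : ℝ) * z)
        (Polynomial.derivative (Polynomial.hermite k)) * (√2 : ℝ)) /
        (√(2 ^ k * (k.factorial : ℝ) * √Real.pi) : ℝ)) z := by
  have h1 : HasDerivAt (fun z : ℂ => ((√2 : ℝ) : ℂ) * z) ((√2 : ℝ) : ℂ) z := by
    simpa using (hasDerivAt_id z).const_mul ((√2 : ℝ) : ℂ)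
  have h2 := (Polynomial.hasDerivAt_aeval (Polynomial.hermite k) (((√2 : ℝ) : ℂ) * z)).comp z h1
  exact (h2.const_mul _).div_const _

theorem hasDerivAt_complexHermite_succ (k : ℕ) (z : ℂ) :
    HasDerivAt (complexHermite (k + 1)) ((√(2 * (k + 1)) : ℝ) * complexHermite k z) z := by
  convert hasDerivAt_complexHermite_aux (k + 1) z using 1
  have h1 := sqrt_two_mul_succ_ne_zero k
  have h2 : ((√(2 ^ k * (k.factorial : ℝ) * √Real.pi) : ℝ) : ℂ) ≠ 0 := by
    have : 0 < √(2 ^ k * (k.factorial : ℝ) * √Real.pi) := by positivity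
    exact_mod_cast this.ne'
  have h3 := ofReal_sqrt_mul_self (a := 2 * ((k : ℝ) + 1)) (by positivity)
  have h4 := ofReal_sqrt_mul_self (a := 2) (by positivity)
  rw [sqrt_two_pow_factorial_succ, Polynomial.derivative_hermite_succ, complexHermite, map_nsmul,
    Complex.ofReal_mul]
  simp only [nsmul_eq_mul]
  field_simp
  push_cast at h3 h4 ⊢
  linear_combination ((√2 : ℝ) : ℂ) ^ k *
    Polynomial.aeval (((√2 : ℝ) : ℂ) * z) (Polynomial.hermite k) * (h3 - (k + 1) * h4)

theorem hasDerivAt_complexHermite (k : ℕ) (z : ℂ) :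
    HasDerivAt (complexHermite k)
      (2 * z * complexHermite k z - (√(2 * (k + 1)) : ℝ) * complexHermite (k + 1) z) z := by
  convert hasDerivAt_complexHermite_aux k z using 1
  have h1 := sqrt_two_mul_succ_ne_zero k
  have h2 : ((√(2 ^ k * (k.factorial : ℝ) * √Real.pi) : ℝ) : ℂ) ≠ 0 := by
    have : 0 < √(2 ^ k * (k.factorial : ℝ) * √Real.pi) := by positivity
    exact_mod_cast this.ne'
  have h4 := ofReal_sqrt_mul_self (a := 2) (by positivity)
  rw [complexHermite, complexHermite, sqrt_two_pow_factorial_succ, Polynomial.hermite_succ,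
    Complex.ofReal_mul]
  simp only [map_sub, map_mul, Polynomial.aeval_X]
  generalize Polynomial.aeval (((√2 : ℝ) : ℂ) * z) (Polynomial.hermite k) = p
  generalize Polynomial.aeval (((√2 : ℝ) : ℂ) * z)
    (Polynomial.derivative (Polynomial.hermite k)) = q
  field_simp
  push_cast at h4 ⊢
  linear_combination -((√2 : ℝ) : ℂ) ^ k * z * p * h4

theorem differentiable_complexHermite (k : ℕ) : Differentiable ℂ (complexHermite k) :=
  fun z => (hasDerivAt_complexHermite k z).differentiableAt

theorem complexHermite_zero (z : ℂ) :
    complexHermite 0 z = ((√(√Real.pi) : ℝ) : ℂ)⁻¹ := by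
  simp [complexHermite]

/-- The lowering and raising formulas for the derivative of the same polynomial are compared. -/
theorem complexHermite_add_two (k : ℕ) (z : ℂ) :
    (√(2 * (k + 2)) : ℝ) * complexHermite (k + 2) z
      = 2 * z * complexHermite (k + 1) z - (√(2 * (k + 1)) : ℝ) * complexHermite k z := by
  have h := (hasDerivAt_complexHermite (k + 1) z).unique (hasDerivAt_complexHermite_succ k z)
  rw [← h]
  push_cast
  rw [show (k : ℝ) + 1 + 1 = k + 2 by ring]
  ring

theorem sqrt_two_mul_complexHermite_one (z : ℂ) :
    (√2 : ℝ) * complexHermite 1 z = 2 * z * complexHermite 0 z := by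
  have h0 : HasDerivAt (complexHermite 0) 0 z := by
    rw [show complexHermite 0 = fun _ => _ from funext complexHermite_zero]
    exact hasDerivAt_const _ _
  have h := (hasDerivAt_complexHermite 0 z).unique h0
  simp only [Nat.cast_zero, zero_add, mul_one] at h
  linear_combination -h

/-! ### Growth of the Hermite polynomials. -/

theorem norm_complexHermite_zero_le (z : ℂ) : ‖complexHermite 0 z‖ ≤ 1 := by
  rw [complexHermite_zero, norm_inv, Complex.norm_real, Real.norm_of_nonneg (by positivity)]
  apply inv_le_one_of_one_le₀
  rw [Real.one_le_sqrt, Real.one_le_sqrt]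
  linarith [Real.pi_gt_three]

/-- The right side exceeds 1 by exactly `(√(k + 1) - √k)²`. -/
theorem inv_two_mul_sqrt_le (k : ℕ) : 1 ≤ 2 * √((k : ℝ) + 1) * (√((k : ℝ) + 1) - √k) := by
  have h1 := Real.mul_self_sqrt (show (0:ℝ) ≤ k by positivity)
  have h2 := Real.mul_self_sqrt (show (0:ℝ) ≤ k + 1 by positivity)
  nlinarith [sq_nonneg (√((k : ℝ) + 1) - √k)]

/-- Induction on the three-term recurrence. One step costs a factor `1 + √2|z|/√(k + 2)`; the
increment of the square root is at least `1/(2√(k + 2))`, and `√2 ≤ 3/2`, so `1 + t ≤ exp t` absorbs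
it. -/
theorem norm_complexHermite_le (k : ℕ) (z : ℂ) :
    ‖complexHermite k z‖ ≤ Real.exp (3 * ‖z‖ * √k) := by
  have hs2 : 0 < √(2:ℝ) := by positivity
  have hs2' := Real.mul_self_sqrt (show (0:ℝ) ≤ 2 by positivity)
  have hs3 : √(2:ℝ) ≤ 3 / 2 := by
    rw [Real.sqrt_le_left (by norm_num)]; norm_num
  induction k using Nat.twoStepInduction with
  | zero => simpa using norm_complexHermite_zero_le z
  | one =>
    have h := congrArg norm (sqrt_two_mul_complexHermite_one z)
    simp only [norm_mul, Complex.norm_real, Real.norm_of_nonneg hs2.le, Complex.norm_ofNat] at h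
    have h0 := norm_complexHermite_zero_le z
    have h1 : ‖complexHermite 1 z‖ ≤ √2 * ‖z‖ := by
      have : √2 * ‖complexHermite 1 z‖ ≤ √2 * (√2 * ‖z‖) := by
        rw [h, ← mul_assoc, hs2']
        exact mul_le_of_le_one_right (by positivity) h0
      exact le_of_mul_le_mul_left this hs2
    have h2 := Real.add_one_le_exp (3 * ‖z‖ * √(1 : ℕ))
    simp only [Nat.cast_one, Real.sqrt_one, mul_one] at h2 ⊢
    nlinarith [norm_nonneg z]
  | more k ih1 ih2 =>
    have hp : (0:ℝ) < √((k:ℝ) + 2) := by positivity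
    have h := congrArg norm (complexHermite_add_two k z)
    rw [Real.sqrt_mul (by norm_num), Real.sqrt_mul (by norm_num)] at h
    have h' := h.le.trans (norm_sub_le _ _)
    simp only [norm_mul, Complex.norm_real, Real.norm_of_nonneg (Real.sqrt_nonneg _),
      Complex.norm_ofNat, Complex.ofReal_mul] at h'
    have hmono : √((k:ℝ) + 1) ≤ √((k:ℝ) + 2) := Real.sqrt_le_sqrt (by linarith)
    have hmono' : √(k:ℝ) ≤ √((k:ℝ) + 1) := Real.sqrt_le_sqrt (by linarith)
    have hgap := inv_two_mul_sqrt_le (k + 1)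
    push_cast at hgap ih2 ⊢
    rw [show (k : ℝ) + 1 + 1 = k + 2 by ring] at hgap
    have hE : Real.exp (3 * ‖z‖ * √(k:ℝ)) ≤ Real.exp (3 * ‖z‖ * √((k:ℝ) + 1)) := by
      gcongr
    set E := Real.exp (3 * ‖z‖ * √((k:ℝ) + 1)) with hEdef
    have h1 : √2 * (√((k:ℝ) + 2) * ‖complexHermite (k + 2) z‖)
        ≤ √2 * ((√2 * ‖z‖ + √((k:ℝ) + 2)) * E) := by
      calc _ = √2 * √((k:ℝ) + 2) * ‖complexHermite (k + 2) z‖ := by ring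
        _ ≤ _ := h'
        _ ≤ 2 * ‖z‖ * E + √2 * √((k:ℝ) + 2) * E := by
          gcongr
          exact ih1.trans hE
        _ = (√2 * √2) * ‖z‖ * E + √2 * √((k:ℝ) + 2) * E := by rw [hs2']
        _ = _ := by ring
    have h2 := le_of_mul_le_mul_left h1 hs2
    have h3 : √2 * ‖z‖ + √((k:ℝ) + 2)
        ≤ √((k:ℝ) + 2) * (3 * ‖z‖ * (√((k:ℝ) + 2) - √((k:ℝ) + 1)) + 1) := by
      nlinarith [norm_nonneg z]
    have h4 := Real.add_one_le_exp (3 * ‖z‖ * (√((k:ℝ) + 2) - √((k:ℝ) + 1)))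
    have h5 : Real.exp (3 * ‖z‖ * √((k:ℝ) + 2))
        = Real.exp (3 * ‖z‖ * (√((k:ℝ) + 2) - √((k:ℝ) + 1))) * E := by
      rw [hEdef, ← Real.exp_add]; congr 1; ring
    rw [h5]
    refine le_of_mul_le_mul_left (h2.trans ?_) hp
    rw [← mul_assoc]
    gcongr
    exact h3.trans (by gcongr)

theorem exists_norm_complexHermite_le {ε : ℝ} (hε : 0 < ε) :
    ∃ B : ℝ, 0 < B ∧ ∀ k z, ‖complexHermite k z‖ ≤ B ^ k * Real.exp (ε * ‖z‖ ^ 2) := by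
  -- Completing the square: `3|z|√k ≤ ε|z|² + 9k/(4ε)`.
  refine ⟨Real.exp (9 / (4 * ε)), Real.exp_pos _, fun k z => (norm_complexHermite_le k z).trans ?_⟩
  rw [← Real.exp_nat_mul, ← Real.exp_add, Real.exp_le_exp]
  have h : k * (9 / (4 * ε)) + ε * ‖z‖ ^ 2 - 3 * ‖z‖ * √k
      = ε * (‖z‖ - 3 * √k / (2 * ε)) ^ 2 := by
    have := Real.sq_sqrt (show (0:ℝ) ≤ k by positivity)
    field_simp
    linear_combination (-9 * 4) * this
  nlinarith [mul_nonneg hε.le (sq_nonneg (‖z‖ - 3 * √k / (2 * ε)))]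

/-- Entire functions of order at most two and minimal type. -/
def IsEntireOfMinimalGaussianType (F : ℂ → ℂ) : Prop :=
  Differentiable ℂ F ∧ ∀ ε : ℝ, 0 < ε → ∃ C : ℝ, ∀ z : ℂ, ‖F z‖ ≤ C * Real.exp (ε * ‖z‖ ^ 2)

/-! ### Entire functions of minimal type: Cauchy estimates and integrability. -/

namespace IsEntireOfMinimalGaussianType

variable {F G : ℂ → ℂ}

theorem complexHermite (k : ℕ) : IsEntireOfMinimalGaussianType (complexHermite k) :=
  ⟨differentiable_complexHermite k, fun _ hε =>
    let ⟨B, _, hB⟩ := exists_norm_complexHermite_le hε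
    ⟨B ^ k, hB k⟩⟩

theorem exists_nonneg (hF : IsEntireOfMinimalGaussianType F) {ε : ℝ} (hε : 0 < ε) :
    ∃ C : ℝ, 0 ≤ C ∧ ∀ z : ℂ, ‖F z‖ ≤ C * Real.exp (ε * ‖z‖ ^ 2) := by
  obtain ⟨C, hC⟩ := hF.2 ε hε
  exact ⟨C, by simpa using (norm_nonneg _).trans (hC 0), hC⟩

theorem mul (hF : IsEntireOfMinimalGaussianType F) (hG : IsEntireOfMinimalGaussianType G) :
    IsEntireOfMinimalGaussianType fun z => F z * G z := by
  refine ⟨hF.1.mul hG.1, fun ε hε => ?_⟩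
  obtain ⟨C, hC0, hC⟩ := hF.exists_nonneg (half_pos hε)
  obtain ⟨D, hD0, hD⟩ := hG.exists_nonneg (half_pos hε)
  refine ⟨C * D, fun z => ?_⟩
  have h : Real.exp (ε * ‖z‖ ^ 2) = Real.exp (ε / 2 * ‖z‖ ^ 2) * Real.exp (ε / 2 * ‖z‖ ^ 2) := by
    rw [← Real.exp_add]; congr 1; ring
  rw [norm_mul, h]
  calc _ ≤ (C * Real.exp (ε / 2 * ‖z‖ ^ 2)) * (D * Real.exp (ε / 2 * ‖z‖ ^ 2)) := by
        gcongr
        exacts [hC z, hD z]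
    _ = _ := by ring

theorem norm_le_of_mem_sphere {C ε R : ℝ} (hC0 : 0 ≤ C) (hε : 0 < ε)
    (hC : ∀ z : ℂ, ‖F z‖ ≤ C * Real.exp (ε * ‖z‖ ^ 2)) {z w : ℂ} (hw : w ∈ Metric.sphere z R) :
    ‖F w‖ ≤ C * Real.exp (2 * ε * ‖z‖ ^ 2 + 2 * ε * R ^ 2) := by
  refine (hC w).trans ?_
  have h1 : ‖w‖ ≤ ‖z‖ + R := by
    rw [mem_sphere_iff_norm] at hw
    calc ‖w‖ = ‖z + (w - z)‖ := by ring_nf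
      _ ≤ ‖z‖ + ‖w - z‖ := norm_add_le _ _
      _ = _ := by rw [hw]
  have h2 : ‖w‖ ^ 2 ≤ 2 * ‖z‖ ^ 2 + 2 * R ^ 2 := by
    nlinarith [norm_nonneg w, sq_nonneg (‖z‖ - R)]
  gcongr
  nlinarith

theorem norm_iteratedDeriv_le (hF : Differentiable ℂ F) {C ε R : ℝ} (hC0 : 0 ≤ C) (hε : 0 < ε)
    (hR : 0 < R) (hC : ∀ z : ℂ, ‖F z‖ ≤ C * Real.exp (ε * ‖z‖ ^ 2)) (k : ℕ) (z : ℂ) :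
    ‖iteratedDeriv k F z‖
      ≤ k.factorial * (C * Real.exp (2 * ε * ‖z‖ ^ 2 + 2 * ε * R ^ 2)) / R ^ k :=
  Complex.norm_iteratedDeriv_le_of_forall_mem_sphere_norm_le k hR hF.diffContOnCl
    fun _ hw => norm_le_of_mem_sphere hC0 hε hC hw

theorem deriv (hF : IsEntireOfMinimalGaussianType F) :
    IsEntireOfMinimalGaussianType (deriv F) := by
  refine ⟨hF.1.deriv, fun ε hε => ?_⟩
  obtain ⟨C, hC0, hC⟩ := hF.exists_nonneg (half_pos hε)
  refine ⟨C * Real.exp ε, fun z => ?_⟩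
  have h := norm_iteratedDeriv_le hF.1 hC0 (half_pos hε) one_pos hC 1 z
  simp only [iteratedDeriv_one, Nat.factorial_one, Nat.cast_one, one_mul, one_pow, div_one,
    mul_one, mul_div_cancel₀ ε (two_ne_zero' ℝ), Real.exp_add] at h
  linarith

theorem continuous_comp_ofReal (hF : IsEntireOfMinimalGaussianType F) :
    Continuous fun x : ℝ => F x :=
  hF.1.continuous.comp Complex.continuous_ofReal

theorem integrable_exp_mul (hF : IsEntireOfMinimalGaussianType F) (a : ℝ) :
    Integrable fun x : ℝ => (Real.exp (a * |x| - x ^ 2) : ℂ) * F x := by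
  -- With `a|x| ≤ a² + x²/4`, this leaves the integrable majorant `exp(-x²/2)`.
  obtain ⟨C, hC0, hC⟩ := hF.exists_nonneg (ε := 1 / 4) (by norm_num)
  have hg := (integrable_exp_neg_mul_sq (b := 1 / 2) (by norm_num)).const_mul (C * Real.exp (a ^ 2))
  refine hg.mono' (Continuous.aestronglyMeasurable ?_) (.of_forall fun x => ?_)
  · exact (Complex.continuous_ofReal.comp (by fun_prop)).mul hF.continuous_comp_ofReal
  · rw [norm_mul, Complex.norm_real, Real.norm_of_nonneg (Real.exp_pos _).le]
    have h := hC x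
    rw [Complex.norm_real, Real.norm_eq_abs, sq_abs] at h
    calc _ ≤ Real.exp (a * |x| - x ^ 2) * (C * Real.exp (1 / 4 * x ^ 2)) := by gcongr
      _ = C * Real.exp (a * |x| - x ^ 2 + 1 / 4 * x ^ 2) := by rw [Real.exp_add]; ring
      _ ≤ C * Real.exp (a ^ 2 + -(1 / 2) * x ^ 2) := by
        refine mul_le_mul_of_nonneg_left (Real.exp_le_exp.mpr ?_) hC0
        nlinarith [sq_nonneg (a - |x| / 2), sq_abs x]
      _ = _ := by rw [Real.exp_add]; ring

theorem integrable_mul_exp_neg_sq (hF : IsEntireOfMinimalGaussianType F) :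
    Integrable fun x : ℝ => F x * (Real.exp (-x ^ 2) : ℂ) := by
  convert hF.integrable_exp_mul 0 using 2 with x
  rw [mul_comm, zero_mul, zero_sub]

end IsEntireOfMinimalGaussianType

/-! ### Integration by parts and decay of the coefficients. -/

theorem hermiteCoeff_eq_integral_complexHermite (f : ℝ → ℂ) (k : ℕ) :
    hermiteCoeff f k = ∫ x : ℝ, f x * complexHermite k x * (Real.exp (-x ^ 2) : ℂ) := by
  simp only [hermiteCoeff, complexHermite_ofReal]

theorem hasDerivAt_complexHermite_mul_exp_neg_sq (k : ℕ) (x : ℝ) :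
    HasDerivAt (fun x : ℝ => complexHermite k x * (Real.exp (-x ^ 2) : ℂ))
      (-((√(2 * (k + 1)) : ℝ) * (complexHermite (k + 1) x * (Real.exp (-x ^ 2) : ℂ)))) x := by
  have h1 := (hasDerivAt_complexHermite k x).comp_ofReal
  have h2 : HasDerivAt (fun x : ℝ => Real.exp (-x ^ 2)) (Real.exp (-x ^ 2) * -(2 * x)) x := by
    simpa using (hasDerivAt_pow 2 x).neg.exp
  refine (h1.mul h2.ofReal_comp).congr_deriv ?_
  push_cast
  ring

namespace IsEntireOfMinimalGaussianType

variable {F : ℂ → ℂ}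

theorem integrable_hermite (hF : IsEntireOfMinimalGaussianType F) (k : ℕ) :
    Integrable fun x : ℝ => F x * (_root_.complexHermite k x * (Real.exp (-x ^ 2) : ℂ)) := by
  simpa only [mul_assoc] using (hF.mul (complexHermite k)).integrable_mul_exp_neg_sq

theorem hermiteCoeff_succ (hF : IsEntireOfMinimalGaussianType F) (k : ℕ) :
    (√(2 * (k + 1)) : ℝ) * hermiteCoeff (fun x => F x) (k + 1)
      = hermiteCoeff (fun x => _root_.deriv F x) k := by
  simp only [hermiteCoeff_eq_integral_complexHermite, mul_assoc]
  have h := integral_mul_deriv_eq_deriv_mul_of_integrable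
    (u := fun x : ℝ => F x) (u' := fun x : ℝ => _root_.deriv F x)
    (v := fun x : ℝ => _root_.complexHermite k x * (Real.exp (-x ^ 2) : ℂ))
    (v' := fun x : ℝ => -((√(2 * (k + 1)) : ℝ) *
      (_root_.complexHermite (k + 1) x * (Real.exp (-x ^ 2) : ℂ))))
    (fun x _ => (hF.1 x).hasDerivAt.comp_ofReal)
    (fun x _ => hasDerivAt_complexHermite_mul_exp_neg_sq k x)
    (by
      have := ((hF.integrable_hermite (k + 1)).const_mul ((√(2 * (k + 1)) : ℝ) : ℂ)).neg
      refine this.congr (.of_forall fun x => ?_)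
      simp only [Pi.neg_apply, Pi.mul_apply]
      ring)
    (hF.deriv.integrable_hermite k) (hF.integrable_hermite k)
  rw [← neg_eq_iff_eq_neg] at h
  rw [← h, ← integral_const_mul, ← integral_neg]
  congr 1 with x
  ring

theorem hermiteCoeff_eq_iteratedDeriv (hF : IsEntireOfMinimalGaussianType F) (k : ℕ) :
    (√(2 ^ k * k.factorial) : ℝ) * hermiteCoeff (fun x => F x) k
      = hermiteCoeff (fun x => iteratedDeriv k F x) 0 := by
  induction k generalizing F with
  | zero => simp
  | succ k ih =>
    rw [iteratedDeriv_succ', ← ih hF.deriv, ← hF.hermiteCoeff_succ, ← mul_assoc,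
      ← Complex.ofReal_mul, ← Real.sqrt_mul (by positivity), Nat.factorial_succ]
    congr 3
    push_cast
    ring

/-- Cauchy's estimate contributes `k!/R ^ k` with `R = M√(k + 1)`. Since `√(k!) ≤ √(k + 1) ^ k`,
division by `√(2 ^ k k!)` leaves at most `M ^ (-k)` times the growth factor `exp(2(k + 1))`. -/
theorem exists_norm_hermiteCoeff_le (hF : IsEntireOfMinimalGaussianType F) {q : ℝ} (hq : 0 < q) :
    ∃ C : ℝ, 0 ≤ C ∧ ∀ k, ‖hermiteCoeff (fun x => F x) k‖ ≤ C * q ^ k := by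
  -- `M` makes `exp(2k)/M ^ k = q ^ k`. Below, `ε` satisfies `εM² ≤ 1`, bounding the growth in `R`
  -- by `exp(2(k + 1))`, and `2ε ≤ 1/2`, leaving the weight `exp(-x²/2)`.
  set M := Real.exp 2 / q with hM
  have hM0 : 0 < M := by positivity
  set ε := 1 / (4 + M ^ 2) with hε
  have hε0 : 0 < ε := by positivity
  have hε1 : 2 * ε ≤ 1 / 2 := by
    rw [hε, mul_one_div, div_le_div_iff₀ (by positivity) (by norm_num)]
    nlinarith [sq_nonneg M]
  have hε2 : ε * M ^ 2 ≤ 1 := by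
    rw [hε, one_div_mul_eq_div, div_le_one (by positivity)]
    linarith
  obtain ⟨C, hC0, hC⟩ := hF.exists_nonneg hε0
  set J := ∫ x : ℝ, Real.exp (-(1 / 2) * x ^ 2) with hJ
  have hJ0 : 0 ≤ J := integral_nonneg fun x => (Real.exp_pos _).le
  refine ⟨C * Real.exp 2 * J, by positivity, fun k => ?_⟩
  set R := M * √((k : ℝ) + 1) with hR
  have hR0 : 0 < R := by positivity
  have hR2 : R ^ 2 = M ^ 2 * (k + 1) := by rw [hR, mul_pow, Real.sq_sqrt (by positivity)]
  have hbound : ‖hermiteCoeff (fun x => iteratedDeriv k F x) 0‖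
      ≤ (k.factorial * (C * Real.exp (2 * (k + 1))) / R ^ k) * J := by
    rw [hJ, ← integral_const_mul, hermiteCoeff_eq_integral_complexHermite]
    refine norm_integral_le_of_norm_le
      ((integrable_exp_neg_mul_sq (b := 1 / 2) (by norm_num)).const_mul _) (.of_forall fun x => ?_)
    have h1 := norm_iteratedDeriv_le hF.1 hC0 hε0 hR0 hC k x
    rw [Complex.norm_real, Real.norm_eq_abs, sq_abs] at h1
    rw [norm_mul, norm_mul, Complex.norm_real, Real.norm_of_nonneg (Real.exp_pos _).le]
    have h2 : Real.exp (2 * ε * x ^ 2 + 2 * ε * R ^ 2)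
        ≤ Real.exp (1 / 2 * x ^ 2) * Real.exp (2 * (k + 1)) := by
      rw [← Real.exp_add, hR2]
      refine Real.exp_le_exp.mpr ?_
      have : ε * M ^ 2 * (k + 1) ≤ 1 * (k + 1) := by gcongr
      nlinarith [sq_nonneg x]
    have h3 : Real.exp (1 / 2 * x ^ 2) * Real.exp (-x ^ 2) = Real.exp (-(1 / 2) * x ^ 2) := by
      rw [← Real.exp_add]; congr 1; ring
    calc _ ≤ (k.factorial * (C * (Real.exp (1 / 2 * x ^ 2) * Real.exp (2 * (k + 1)))) / R ^ k) * 1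
          * Real.exp (-x ^ 2) := by
          gcongr
          · exact h1.trans (by gcongr)
          · exact norm_complexHermite_zero_le x
      _ = (k.factorial * (C * Real.exp (2 * (k + 1))) / R ^ k) *
          (Real.exp (1 / 2 * x ^ 2) * Real.exp (-x ^ 2)) := by ring
      _ = _ := by rw [h3]
  rw [← hF.hermiteCoeff_eq_iteratedDeriv k, norm_mul, Complex.norm_real,
    Real.norm_of_nonneg (Real.sqrt_nonneg _)] at hbound
  have hs : 0 < √(k.factorial : ℝ) := by positivity
  have hs2 := Real.mul_self_sqrt (Nat.cast_nonneg (α := ℝ) k.factorial)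
  have hs3 : √(k.factorial : ℝ) ≤ √((k : ℝ) + 1) ^ k := by
    rw [Real.sqrt_le_left (by positivity), ← pow_mul, mul_comm k 2, pow_mul,
      Real.sq_sqrt (by positivity)]
    calc ((k.factorial : ℕ) : ℝ) ≤ ((k ^ k : ℕ) : ℝ) := by exact_mod_cast k.factorial_le_pow
      _ = (k : ℝ) ^ k := by push_cast; rfl
      _ ≤ _ := by gcongr; linarith
  have hs4 : √(k.factorial : ℝ) ≤ √(2 ^ k * (k.factorial : ℝ)) := by
    apply Real.sqrt_le_sqrt
    exact le_mul_of_one_le_left (by positivity) (one_le_pow₀ (by norm_num))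
  have he : Real.exp (2 * (k + 1)) = Real.exp 2 * Real.exp 2 ^ k := by
    rw [← Real.exp_nat_mul, ← Real.exp_add]; congr 1; ring
  have hqM : Real.exp 2 ^ k = q ^ k * M ^ k := by
    rw [← mul_pow, hM, mul_div_cancel₀ _ hq.ne']
  refine le_of_mul_le_mul_left (a := √(k.factorial : ℝ)) ?_ hs
  calc _ ≤ √(2 ^ k * (k.factorial : ℝ)) * ‖hermiteCoeff (fun x => F x) k‖ := by gcongr
    _ ≤ _ := hbound
    _ = √(k.factorial : ℝ) * (√(k.factorial : ℝ) / √((k : ℝ) + 1) ^ k) *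
        (C * Real.exp 2 * J * q ^ k) := by
      rw [he, hqM, hR, mul_pow]
      nth_rw 1 [← hs2]
      field_simp
    _ ≤ √(k.factorial : ℝ) * 1 * (C * Real.exp 2 * J * q ^ k) := by
      gcongr
      rw [div_le_one (by positivity)]
      exact hs3
    _ = _ := by ring

theorem summable_norm_hermiteCoeff_sq (hF : IsEntireOfMinimalGaussianType F) {θ : ℝ} (hθ : 0 < θ) :
    Summable fun k : ℕ => ‖hermiteCoeff (fun x => F x) k‖ ^ 2 * θ ^ k := by
  -- This `q` gives the geometric ratio `q²θ = θ/(1 + θ)² < 1`.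
  obtain ⟨C, hC0, hC⟩ := hF.exists_norm_hermiteCoeff_le (q := 1 / (1 + θ)) (by positivity)
  have hr : θ / (1 + θ) ^ 2 < 1 := by
    rw [div_lt_one (by positivity)]; nlinarith
  refine .of_nonneg_of_le (fun k => by positivity) (fun k => ?_)
    ((summable_geometric_of_lt_one (by positivity) hr).mul_left (C ^ 2))
  calc _ ≤ (C * (1 / (1 + θ)) ^ k) ^ 2 * θ ^ k := by
        gcongr
        exact hC k
    _ = _ := by
      rw [div_pow, div_pow, ← pow_mul, mul_pow, div_pow, ← pow_mul, mul_comm k 2]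
      simp
      ring

end IsEntireOfMinimalGaussianType

/-- Orthonormality: integration by parts lowers both indices at once, down to the Gaussian integral
or to the derivative of a constant. -/
theorem hermiteCoeff_complexHermite (j k : ℕ) :
    hermiteCoeff (fun x => complexHermite j x) k = if j = k then 1 else 0 := by
  have hsymm (j k : ℕ) : hermiteCoeff (fun x => complexHermite j x) k
      = hermiteCoeff (fun x => complexHermite k x) j := by
    simp only [hermiteCoeff_eq_integral_complexHermite]
    congr 1 with x
    ring
  have hzero (k : ℕ) : hermiteCoeff (fun x => complexHermite 0 x) (k + 1) = 0 := by
    have h := (IsEntireOfMinimalGaussianType.complexHermite 0).hermiteCoeff_succ k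
    have hd : deriv (complexHermite 0) = fun _ => 0 := by
      rw [show complexHermite 0 = fun _ => _ from funext complexHermite_zero]
      simp
    rw [hd] at h
    refine (mul_eq_zero.mp (h.trans ?_)).resolve_left (sqrt_two_mul_succ_ne_zero k)
    simp [hermiteCoeff]
  induction k generalizing j with
  | zero =>
    cases j with
    | zero =>
      have hπ := ofReal_sqrt_mul_self (a := √Real.pi) (by positivity)
      have hπ0 : ((√(√Real.pi) : ℝ) : ℂ) ≠ 0 := by
        have : 0 < √(√Real.pi) := by positivity
        exact_mod_cast this.ne'
      have hg : ∫ x : ℝ, (Real.exp (-x ^ 2) : ℂ) = (√Real.pi : ℝ) := by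
        rw [integral_complex_ofReal]
        simpa using integral_gaussian 1
      rw [if_pos rfl, hermiteCoeff_eq_integral_complexHermite]
      simp only [complexHermite_zero]
      rw [integral_const_mul, hg, ← hπ]
      field_simp
    | succ j => rw [hsymm, hzero]; simp
  | succ k ih =>
    cases j with
    | zero => rw [hzero]; simp
    | succ j =>
      have h := (IsEntireOfMinimalGaussianType.complexHermite (j + 1)).hermiteCoeff_succ k
      have hd : deriv (complexHermite (j + 1))
          = fun z => (√(2 * (j + 1)) : ℝ) * complexHermite j z :=
        funext fun z => (hasDerivAt_complexHermite_succ j z).deriv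
      have hm : hermiteCoeff (fun x => (√(2 * (j + 1)) : ℝ) * complexHermite j x) k
          = (√(2 * (j + 1)) : ℝ) * hermiteCoeff (fun x => complexHermite j x) k := by
        simp only [hermiteCoeff, mul_assoc]
        rw [integral_const_mul]
      rw [hd, hm, ih] at h
      refine mul_left_cancel₀ (sqrt_two_mul_succ_ne_zero k) (h.trans ?_)
      simp only [Nat.add_right_cancel_iff]
      split_ifs with hjk
      · rw [hjk]
      · simp

/-! ### Determinacy of the moment problem under an exponential moment. -/

section Determinacy

variable {v : ℝ → ℝ} {a : ℝ}

theorem aestronglyMeasurable_of_integrable_exp_mul {E : Type*} [NormedAddCommGroup E]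
    [NormedSpace ℝ E] {u : ℝ → E} (hu : Integrable fun x => Real.exp (a * |x|) • u x) :
    AEStronglyMeasurable u volume := by
  have h : AEStronglyMeasurable (fun x => Real.exp (-(a * |x|)) • Real.exp (a * |x|) • u x) :=
    (Continuous.aestronglyMeasurable (by fun_prop)).smul hu.1
  refine h.congr (.of_forall fun x => ?_)
  simp only [smul_smul, ← Real.exp_add]
  simp

theorem integrable_smul_of_norm_le_exp {E : Type*} [NormedAddCommGroup E]
    [NormedSpace ℝ E] {u : ℝ → E} (hu : Integrable fun x => Real.exp (a * |x|) • u x)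
    {h : ℝ → ℝ} (hc : Continuous h) {K : ℝ} (hK : ∀ x, |h x| ≤ K * Real.exp (a * |x|)) :
    Integrable fun x => h x • u x := by
  refine (hu.norm.const_mul K).mono'
    (hc.aestronglyMeasurable.smul (aestronglyMeasurable_of_integrable_exp_mul hu))
    (.of_forall fun x => ?_)
  rw [norm_smul, norm_smul, Real.norm_eq_abs, Real.norm_of_nonneg (Real.exp_pos _).le, ← mul_assoc]
  exact mul_le_mul_of_nonneg_right (hK x) (norm_nonneg _)

theorem abs_pow_le_factorial_mul_exp (ha : 0 < a) (n : ℕ) (x : ℝ) :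
    |x ^ n| ≤ n.factorial / a ^ n * Real.exp (a * |x|) := by
  have h := Real.pow_div_factorial_le_exp (a * |x|) (by positivity) n
  rw [mul_pow, div_le_iff₀ (by positivity)] at h
  rw [abs_pow, div_mul_eq_mul_div, le_div_iff₀ (by positivity)]
  linarith

theorem integrable_pow_smul {E : Type*} [NormedAddCommGroup E] [NormedSpace ℝ E] {u : ℝ → E}
    (ha : 0 < a) (hu : Integrable fun x => Real.exp (a * |x|) • u x) (n : ℕ) :
    Integrable fun x => x ^ n • u x :=
  integrable_smul_of_norm_le_exp hu (by fun_prop) (abs_pow_le_factorial_mul_exp ha n)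

theorem isFiniteMeasure_withDensity_of_exp (ha : 0 < a)
    (hv : Integrable fun x => Real.exp (a * |x|) • v x) :
    IsFiniteMeasure (volume.withDensity fun x => ENNReal.ofReal (v x)) :=
  isFiniteMeasure_withDensity_ofReal (by simpa using (integrable_pow_smul ha hv 0).2)

theorem Ioo_subset_interior_integrableExpSet (hv0 : ∀ x, 0 ≤ v x)
    (hv : Integrable fun x => Real.exp (a * |x|) • v x) :
    Set.Ioo (-a) a ⊆ interior (ProbabilityTheory.integrableExpSet id
      (volume.withDensity fun x => ENNReal.ofReal (v x))) := by
  refine interior_maximal (fun t ht => ?_) isOpen_Ioo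
  rw [ProbabilityTheory.integrableExpSet, Set.mem_ofPred_eq,
    integrable_withDensity_iff_integrable_smul₀'
      (aestronglyMeasurable_of_integrable_exp_mul hv).aemeasurable.ennreal_ofReal
      (.of_forall fun _ => ENNReal.ofReal_lt_top)]
  refine (integrable_smul_of_norm_le_exp hv (h := fun x => Real.exp (t * x)) (K := 1) (by fun_prop)
    fun x => ?_).congr (.of_forall fun x => ?_)
  · rw [abs_of_pos (Real.exp_pos _), one_mul, Real.exp_le_exp]
    calc t * x ≤ |t * x| := le_abs_self _
      _ = |t| * |x| := abs_mul _ _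
      _ ≤ a * |x| := by
        gcongr
        exact abs_le.mpr ⟨ht.1.le, ht.2.le⟩
  · simp [ENNReal.toReal_ofReal (hv0 x), mul_comm]

theorem iteratedDeriv_complexMGF_withDensity (ha : 0 < a) (hv0 : ∀ x, 0 ≤ v x)
    (hv : Integrable fun x => Real.exp (a * |x|) • v x) (n : ℕ) :
    iteratedDeriv n (ProbabilityTheory.complexMGF id
      (volume.withDensity fun x => ENNReal.ofReal (v x))) 0 = (∫ x, x ^ n * v x : ℝ) := by
  rw [ProbabilityTheory.iteratedDeriv_complexMGF
    (Ioo_subset_interior_integrableExpSet hv0 hv (by simpa using ha)),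
    integral_withDensity_eq_integral_toReal_smul₀
      (aestronglyMeasurable_of_integrable_exp_mul hv).aemeasurable.ennreal_ofReal
      (.of_forall fun _ => ENNReal.ofReal_lt_top), ← integral_complex_ofReal]
  congr 1 with x
  simp [ENNReal.toReal_ofReal (hv0 x), mul_comm]

/-- Nonnegative functions with an exponential moment are determined by their moments. -/
theorem ae_eq_of_integral_pow_mul_eq {w : ℝ → ℝ} (ha : 0 < a) (hv0 : ∀ x, 0 ≤ v x)
    (hw0 : ∀ x, 0 ≤ w x) (hv : Integrable fun x => Real.exp (a * |x|) • v x)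
    (hw : Integrable fun x => Real.exp (a * |x|) • w x)
    (h : ∀ n : ℕ, ∫ x, x ^ n * v x = ∫ x, x ^ n * w x) : v =ᵐ[volume] w := by
  have := isFiniteMeasure_withDensity_of_exp ha hv
  have := isFiniteMeasure_withDensity_of_exp ha hw
  set μ := volume.withDensity fun x => ENNReal.ofReal (v x) with hμ
  set ν := volume.withDensity fun x => ENNReal.ofReal (w x) with hν
  set U : Set ℂ := Complex.re ⁻¹' Set.Ioo (-a) a
  have hUμ : AnalyticOnNhd ℂ (ProbabilityTheory.complexMGF id μ) U :=
    ProbabilityTheory.analyticOnNhd_complexMGF.mono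
      fun z hz => Ioo_subset_interior_integrableExpSet hv0 hv hz
  have hUν : AnalyticOnNhd ℂ (ProbabilityTheory.complexMGF id ν) U :=
    ProbabilityTheory.analyticOnNhd_complexMGF.mono
      fun z hz => Ioo_subset_interior_integrableExpSet hw0 hw hz
  have hU : IsPreconnected U :=
    ((convex_Ioo (-a) a).linear_preimage Complex.reLm).isPreconnected
  have h0 : (0 : ℂ) ∈ U := by simpa [U] using ha
  have hd := (hUμ 0 h0).sub (hUν 0 h0)
  -- The derivatives at 0 are the moments, so the difference vanishes to infinite order there.
  have hord : analyticOrderAt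
      (ProbabilityTheory.complexMGF id μ - ProbabilityTheory.complexMGF id ν) 0 = ⊤ := by
    refine ENat.eq_top_iff_forall_ge.mpr fun n => ?_
    rw [natCast_le_analyticOrderAt_iff_iteratedDeriv_eq_zero hd]
    intro i _
    rw [iteratedDeriv_sub (hUμ 0 h0).contDiffAt (hUν 0 h0).contDiffAt,
      iteratedDeriv_complexMGF_withDensity ha hv0 hv, iteratedDeriv_complexMGF_withDensity ha hw0 hw,
      h i, sub_self]
  have hev := analyticOrderAt_eq_top.mp hord
  have heq := hUμ.eqOn_of_preconnected_of_eventuallyEq hUν hU h0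
    (hev.mono fun z hz => sub_eq_zero.mp hz)
  -- The strip contains the imaginary axis, where equality means equal characteristic functions.
  have hμν : μ = ν := by
    refine Measure.ext_of_charFun (funext fun t => ?_)
    rw [← ProbabilityTheory.complexMGF_id_mul_I, ← ProbabilityTheory.complexMGF_id_mul_I]
    exact heq (by simpa [U] using ha)
  have hae := (withDensity_eq_iff_of_sigmaFinite
    (aestronglyMeasurable_of_integrable_exp_mul hv).aemeasurable.ennreal_ofReal
    (aestronglyMeasurable_of_integrable_exp_mul hw).aemeasurable.ennreal_ofReal).mp hμν
  filter_upwards [hae] with x hx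
  rwa [ENNReal.ofReal_eq_ofReal_iff (hv0 x) (hw0 x)] at hx

/-- The positive and negative parts have the same moments, so they agree a.e. -/
theorem ae_eq_zero_of_integral_pow_mul_eq_zero {u : ℝ → ℝ} (ha : 0 < a)
    (hu : Integrable fun x => Real.exp (a * |x|) • u x) (h : ∀ n : ℕ, ∫ x, x ^ n * u x = 0) :
    u =ᵐ[volume] 0 := by
  have hp : Integrable fun x => Real.exp (a * |x|) • max (u x) 0 :=
    hu.pos_part.congr (.of_forall fun x => by
      simp [mul_max_of_nonneg _ _ (Real.exp_pos (a * |x|)).le])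
  have hn : Integrable fun x => Real.exp (a * |x|) • max (-u x) 0 :=
    hu.neg_part.congr (.of_forall fun x => by
      simp [mul_max_of_nonneg _ _ (Real.exp_pos (a * |x|)).le])
  have hpn (x : ℝ) : max (u x) 0 - max (-u x) 0 = u x := max_zero_sub_max_neg_zero_eq_self (u x)
  have hae := ae_eq_of_integral_pow_mul_eq ha (fun x => le_max_right (u x) 0)
    (fun x => le_max_right (-u x) 0) hp hn fun n => by
      simp only [← smul_eq_mul (_ ^ n)]
      rw [← sub_eq_zero, ← integral_sub (integrable_pow_smul ha hp n) (integrable_pow_smul ha hn n)]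
      simpa only [smul_eq_mul, ← mul_sub, hpn] using h n
  filter_upwards [hae] with x hx
  rw [Pi.zero_apply, ← hpn x, hx, sub_self]

theorem ae_eq_zero_of_integral_pow_smul_eq_zero {u : ℝ → ℂ} (ha : 0 < a)
    (hu : Integrable fun x => Real.exp (a * |x|) • u x) (h : ∀ n : ℕ, ∫ x, x ^ n • u x = 0) :
    u =ᵐ[volume] 0 := by
  have key (T : ℂ →L[ℝ] ℝ) : (fun x => T (u x)) =ᵐ[volume] 0 := by
    refine ae_eq_zero_of_integral_pow_mul_eq_zero ha ?_ fun n => ?_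
    · simpa only [map_smul] using T.integrable_comp hu
    · have := T.integral_comp_comm (integrable_pow_smul ha hu n)
      rw [h n, map_zero] at this
      simpa only [map_smul, smul_eq_mul] using this
  filter_upwards [key Complex.reCLM, key Complex.imCLM] with x hre him
  exact Complex.ext hre him

end Determinacy

/-! ### Completeness of the Hermite system. -/

section Completeness

variable {a : ℝ}

theorem exists_abs_aeval_le_exp (ha : 0 < a) (p : Polynomial ℤ) :
    ∃ K : ℝ, ∀ x : ℝ, |Polynomial.aeval (√2 * x) p| ≤ K * Real.exp (a * |x|) := by
  induction p using Polynomial.induction_on' with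
  | add p q hp hq =>
    obtain ⟨K, hK⟩ := hp
    obtain ⟨L, hL⟩ := hq
    refine ⟨K + L, fun x => ?_⟩
    rw [map_add, add_mul]
    exact (abs_add_le _ _).trans (add_le_add (hK x) (hL x))
  | monomial n c =>
    refine ⟨|(c : ℝ) * √2 ^ n| * (n.factorial / a ^ n), fun x => ?_⟩
    rw [Polynomial.aeval_monomial, mul_pow, mul_assoc |(c : ℝ) * √2 ^ n|]
    simp only [algebraMap_int_eq, eq_intCast]
    rw [← mul_assoc, abs_mul]
    exact mul_le_mul_of_nonneg_left (abs_pow_le_factorial_mul_exp ha n x) (abs_nonneg _)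

theorem integrable_aeval_smul {u : ℝ → ℂ} (ha : 0 < a)
    (hu : Integrable fun x => Real.exp (a * |x|) • u x) (p : Polynomial ℤ) :
    Integrable fun x => Polynomial.aeval (√2 * x) p • u x := by
  obtain ⟨K, hK⟩ := exists_abs_aeval_le_exp ha p
  exact integrable_smul_of_norm_le_exp hu
    ((Polynomial.continuous_aeval p).comp (continuous_const_mul _)) hK

theorem integral_pow_smul_eq_zero_of_hermite {u : ℝ → ℂ} (ha : 0 < a)
    (hu : Integrable fun x => Real.exp (a * |x|) • u x)
    (h : ∀ k, ∫ x, Polynomial.aeval (√2 * x) (Polynomial.hermite k) • u x = 0) (n : ℕ) :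
    ∫ x, x ^ n • u x = 0 := by
  -- Generalizing over `k` lets the relation `X * He_k = He_(k+1) + He_k'` trade each power of `X`
  -- for a shift of index.
  have key (n k : ℕ) : ∫ x, Polynomial.aeval (√2 * x)
      (Polynomial.X ^ n * Polynomial.hermite k) • u x = 0 := by
    induction n generalizing k with
    | zero => simpa using h k
    | succ n ih =>
      have hadd (p q : Polynomial ℤ) : ∫ x, Polynomial.aeval (√2 * x) (p + q) • u x
          = (∫ x, Polynomial.aeval (√2 * x) p • u x) + ∫ x, Polynomial.aeval (√2 * x) q • u x := by
        rw [← integral_add (integrable_aeval_smul ha hu p) (integrable_aeval_smul ha hu q)]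
        simp only [map_add, add_smul]
      rw [show Polynomial.X ^ (n + 1) * Polynomial.hermite k
        = Polynomial.X ^ n * Polynomial.hermite (k + 1)
          + Polynomial.X ^ n * Polynomial.derivative (Polynomial.hermite k) by
        rw [Polynomial.hermite_succ]; ring, hadd, ih, zero_add]
      cases k with
      | zero => simp
      | succ k =>
        rw [Polynomial.derivative_hermite_succ, mul_smul_comm]
        simp only [map_nsmul, smul_assoc]
        simp only [← Nat.cast_smul_eq_nsmul ℝ]
        rw [integral_smul, ih, smul_zero]
  have hn := key n 0
  simp only [Polynomial.hermite_zero, map_one, mul_one, map_pow, Polynomial.aeval_X, mul_pow,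
    mul_smul] at hn
  rw [integral_smul] at hn
  exact (smul_eq_zero.mp hn).resolve_left (by positivity)

theorem integrable_exp_smul_of_integrable {f : ℝ → ℂ}
    (hf : Integrable fun x : ℝ => (Real.exp (a * |x| - x ^ 2) : ℂ) * f x) :
    Integrable fun x : ℝ => Real.exp (a * |x|) • ((Real.exp (-x ^ 2) : ℂ) * f x) := by
  refine hf.congr (.of_forall fun x => ?_)
  simp only
  rw [Complex.real_smul, ← mul_assoc, ← Complex.ofReal_mul, ← Real.exp_add, sub_eq_add_neg]

theorem orthoHermite_integrand_eq (f : ℝ → ℂ) (k : ℕ) (x : ℝ) :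
    f x * (orthoHermite k x : ℂ) * (Real.exp (-x ^ 2) : ℂ)
      = (√2 ^ k / √(2 ^ k * (k.factorial : ℝ) * √Real.pi)) •
        (Polynomial.aeval (√2 * x) (Polynomial.hermite k)) •
          ((Real.exp (-x ^ 2) : ℂ) * f x) := by
  rw [orthoHermite, physHermite, Complex.real_smul, Complex.real_smul]
  push_cast
  ring

theorem integrable_orthoHermite_mul {f : ℝ → ℂ} (ha : 0 < a)
    (hf : Integrable fun x : ℝ => (Real.exp (a * |x| - x ^ 2) : ℂ) * f x) (k : ℕ) :
    Integrable fun x : ℝ => f x * (orthoHermite k x : ℂ) * (Real.exp (-x ^ 2) : ℂ) := by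
  simp only [orthoHermite_integrand_eq]
  exact (integrable_aeval_smul ha (integrable_exp_smul_of_integrable hf) _).smul
    (√2 ^ k / √(2 ^ k * (k.factorial : ℝ) * √Real.pi))

/-- A function with an exponential moment against the Gaussian weight vanishes almost everywhere
if all its Hermite coefficients vanish. -/
theorem ae_eq_zero_of_hermiteCoeff_eq_zero {f : ℝ → ℂ} (ha : 0 < a)
    (hf : Integrable fun x : ℝ => (Real.exp (a * |x| - x ^ 2) : ℂ) * f x)
    (h : ∀ k, hermiteCoeff f k = 0) : f =ᵐ[volume] 0 := by
  have hu := integrable_exp_smul_of_integrable hf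
  have h0 := ae_eq_zero_of_integral_pow_smul_eq_zero ha hu
    (integral_pow_smul_eq_zero_of_hermite ha hu fun k => by
      have hk := h k
      simp only [hermiteCoeff, orthoHermite_integrand_eq] at hk
      rw [integral_smul] at hk
      exact (smul_eq_zero.mp hk).resolve_left (by positivity))
  filter_upwards [h0] with x hx
  refine (mul_eq_zero.mp hx).resolve_left ?_
  exact_mod_cast (Real.exp_pos _).ne'

end Completeness

/-! ### Hermite series with rapidly decaying coefficients. -/

section HermiteSeries

theorem summable_norm_mul_pow_of_forall_summable {c : ℕ → ℂ}
    (hc : ∀ θ : ℝ, 1 < θ → Summable fun k => ‖c k‖ ^ 2 * θ ^ k) {B : ℝ} (hB : 0 < B) :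
    Summable fun k => ‖c k‖ * B ^ k := by
  -- From `xy ≤ x² + y²` with `x = ‖c k‖ (2B)^k` and `y = (1/2)^k`; the summand 1 ensures `θ > 1`.
  have hs := (hc (1 + 4 * B ^ 2) (by nlinarith [sq_pos_of_pos hB])).add
    (summable_geometric_of_lt_one (r := 1 / 4) (by norm_num) (by norm_num))
  refine .of_nonneg_of_le (fun k => by positivity) (fun k => ?_) hs
  have h1 : (4 * B ^ 2) ^ k ≤ (1 + 4 * B ^ 2) ^ k := by gcongr; linarith
  have h2 : ‖c k‖ * B ^ k = (‖c k‖ * (2 * B) ^ k) * (1 / 2) ^ k := by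
    rw [mul_assoc, ← mul_pow]; congr 2; ring
  have h3 : ‖c k‖ ^ 2 * (4 * B ^ 2) ^ k = (‖c k‖ * (2 * B) ^ k) ^ 2 := by
    rw [mul_pow ‖c k‖, ← pow_mul (2 * B) k 2, mul_comm k 2, pow_mul]; congr 2; ring
  have h4 : ((1 : ℝ) / 4) ^ k = ((1 / 2) ^ k) ^ 2 := by
    rw [← pow_mul, mul_comm k 2, pow_mul]; norm_num
  have h5 : ‖c k‖ ^ 2 * (4 * B ^ 2) ^ k ≤ ‖c k‖ ^ 2 * (1 + 4 * B ^ 2) ^ k := by gcongr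
  have h6 : 0 ≤ ‖c k‖ * (2 * B) ^ k := by positivity
  have h7 : (0 : ℝ) ≤ (1 / 2) ^ k := by positivity
  rw [h2, h4]
  nlinarith [sq_nonneg (‖c k‖ * (2 * B) ^ k - (1 / 2) ^ k)]

variable {c : ℕ → ℂ}

theorem isEntireOfMinimalGaussianType_tsum (hc : ∀ B : ℝ, 0 < B → Summable fun k => ‖c k‖ * B ^ k) :
    IsEntireOfMinimalGaussianType fun z => ∑' k, c k * complexHermite k z := by
  have hterm {B ε : ℝ} (h : ∀ k z, ‖complexHermite k z‖ ≤ B ^ k * Real.exp (ε * ‖z‖ ^ 2))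
      (k : ℕ) (z : ℂ) :
      ‖c k * complexHermite k z‖ ≤ ‖c k‖ * B ^ k * Real.exp (ε * ‖z‖ ^ 2) := by
    rw [norm_mul, mul_assoc]
    exact mul_le_mul_of_nonneg_left (h k z) (norm_nonneg _)
  constructor
  · obtain ⟨B, hB0, hB⟩ := exists_norm_complexHermite_le one_pos
    intro z
    have hd := Complex.differentiableOn_tsum_of_summable_norm (U := Metric.ball 0 (‖z‖ + 1))
      ((hc B hB0).mul_right (Real.exp (1 * (‖z‖ + 1) ^ 2)))
      (fun k => ((differentiable_complexHermite k).const_mul (c k)).differentiableOn)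
      Metric.isOpen_ball fun k w hw => (hterm hB k w).trans (by
        have : ‖w‖ ≤ ‖z‖ + 1 := (mem_ball_zero_iff.mp hw).le
        gcongr)
    exact hd.differentiableAt (Metric.isOpen_ball.mem_nhds (by simp))
  · intro ε hε
    obtain ⟨B, hB0, hB⟩ := exists_norm_complexHermite_le hε
    refine ⟨∑' k, ‖c k‖ * B ^ k, fun z => ?_⟩
    exact tsum_of_norm_bounded ((hc B hB0).hasSum.mul_right _) fun k => hterm hB k z

theorem hermiteCoeff_tsum (hc : ∀ B : ℝ, 0 < B → Summable fun k => ‖c k‖ * B ^ k) (k : ℕ) :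
    hermiteCoeff (fun x => ∑' j, c j * complexHermite j x) k = c k := by
  -- Two Hermite factors cost `exp(x²/2)`, half of the Gaussian weight.
  obtain ⟨B, hB0, hB⟩ := exists_norm_complexHermite_le (ε := 1 / 4) (by norm_num)
  set T : ℕ → ℝ → ℂ := fun j x =>
    c j * (complexHermite j x * complexHermite k x * (Real.exp (-x ^ 2) : ℂ)) with hT
  have hint (j : ℕ) : Integrable (T j) :=
    (((IsEntireOfMinimalGaussianType.complexHermite j).mul
      (.complexHermite k)).integrable_mul_exp_neg_sq).const_mul (c j)
  have hg := integrable_exp_neg_mul_sq (b := 1 / 2) (by norm_num)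
  have hbound (j : ℕ) : ∫ x, ‖T j x‖
      ≤ ‖c j‖ * B ^ j * (B ^ k * ∫ x : ℝ, Real.exp (-(1 / 2) * x ^ 2)) := by
    rw [← integral_const_mul, ← integral_const_mul]
    refine integral_mono (hint j).norm ((hg.const_mul _).const_mul _) fun x => ?_
    have hj := hB j x
    have hk := hB k x
    rw [Complex.norm_real, Real.norm_eq_abs, sq_abs] at hj hk
    simp only [hT, norm_mul, Complex.norm_real, Real.norm_of_nonneg (Real.exp_pos _).le]
    calc _ ≤ ‖c j‖ * (B ^ j * Real.exp (1 / 4 * x ^ 2) * (B ^ k * Real.exp (1 / 4 * x ^ 2))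
          * Real.exp (-x ^ 2)) := by gcongr
      _ = ‖c j‖ * B ^ j * (B ^ k * (Real.exp (1 / 4 * x ^ 2) * Real.exp (1 / 4 * x ^ 2)
          * Real.exp (-x ^ 2))) := by ring
      _ = _ := by
        rw [← Real.exp_add, ← Real.exp_add]
        congr 4
        ring
  have hsum := hasSum_integral_of_summable_integral_norm hint
    (.of_nonneg_of_le (fun j => integral_nonneg fun x => norm_nonneg _) hbound
      ((hc B hB0).mul_right _))
  have hval (j : ℕ) : ∫ x, T j x = if j = k then c k else 0 := by
    have := hermiteCoeff_complexHermite j k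
    rw [hermiteCoeff_eq_integral_complexHermite] at this
    simp only [hT]
    rw [integral_const_mul, this]
    split_ifs with hjk
    · rw [hjk, mul_one]
    · rw [mul_zero]
  simp only [hval] at hsum
  rw [hermiteCoeff_eq_integral_complexHermite, ← hsum.unique (hasSum_ite_eq k (c k))]
  congr 1 with x
  simp only [hT, ← tsum_mul_right, mul_assoc]

end HermiteSeries

/-! ### The equivalence. -/

theorem hermiteCoeff_congr_ae {f g : ℝ → ℂ} (h : f =ᵐ[volume] g) (k : ℕ) :
    hermiteCoeff f k = hermiteCoeff g k :=
  integral_congr_ae (h.mono fun x hx => by simp only [hx])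

theorem hermiteCoeff_sub {f g : ℝ → ℂ} {a : ℝ} (ha : 0 < a)
    (hf : Integrable fun x : ℝ => (Real.exp (a * |x| - x ^ 2) : ℂ) * f x)
    (hg : Integrable fun x : ℝ => (Real.exp (a * |x| - x ^ 2) : ℂ) * g x) (k : ℕ) :
    hermiteCoeff (fun x => f x - g x) k = hermiteCoeff f k - hermiteCoeff g k := by
  simp only [hermiteCoeff]
  rw [← integral_sub (integrable_orthoHermite_mul ha hf k) (integrable_orthoHermite_mul ha hg k)]
  simp only [sub_mul]

end

/-- Measurability and the moment condition stand inside the left side, so the reverse implication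
also contains the "moreover" clause. -/
theorem mainTheorem9 (f : ℝ → ℂ) :
    ((∃ a : ℝ, 0 < a ∧ Integrable (fun x : ℝ => (Real.exp (a * |x| - x ^ 2) : ℂ) * f x) volume) ∧
      ∀ θ : ℝ, 1 < θ → Summable (fun k : ℕ => ‖hermiteCoeff f k‖ ^ 2 * θ ^ k)) ↔
    ∃ F : ℂ → ℂ, Differentiable ℂ F ∧
      (∀ᵐ x : ℝ ∂volume, f x = F (x : ℂ)) ∧
      ∀ ε : ℝ, 0 < ε → ∃ C : ℝ, ∀ z : ℂ, ‖F z‖ ≤ C * Real.exp (ε * ‖z‖ ^ 2) := by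
  constructor
  · rintro ⟨⟨a, ha, hf⟩, hsum⟩
    have hc (B : ℝ) (hB : 0 < B) := summable_norm_mul_pow_of_forall_summable hsum hB
    have hF := isEntireOfMinimalGaussianType_tsum hc
    refine ⟨_, hF.1, ?_, hF.2⟩
    have hFint := hF.integrable_exp_mul a
    have h0 := ae_eq_zero_of_hermiteCoeff_eq_zero ha
      ((hf.sub hFint).congr (.of_forall fun x => (mul_sub _ _ _).symm)) fun k => by
        rw [hermiteCoeff_sub ha hf hFint, hermiteCoeff_tsum hc, sub_self]
    exact h0.mono fun x hx => sub_eq_zero.mp hx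
  · rintro ⟨F, hd, hae, hb⟩
    have hF : IsEntireOfMinimalGaussianType F := ⟨hd, hb⟩
    refine ⟨⟨1, one_pos, (hF.integrable_exp_mul 1).congr (hae.mono fun x hx => ?_)⟩, fun θ hθ => ?_⟩
    · simp only [hx]
    · simpa only [hermiteCoeff_congr_ae hae] using
        hF.summable_norm_hermiteCoeff_sq (zero_lt_one.trans hθ)
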